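/- Let $\mathbb{D}=\{z\in\mathbb{C}:|z|<1\}$, $\mathbb{T}=\partial\mathbb{D}$. Let $H^2(\mathbb{D})$ be the Hardy space of analytic functions $g$ on $\mathbb{D}$ with $\|g\|^2=\sup_{0<r<1}\frac1{2\pi}\int_{-\pi}^{\pi}|g(re^{i\theta})|^2\,d\theta<\infty$, and let $H^\infty(\mathbb{D})$ be the algebra of bounded analytic functions on $\mathbb{D}$. For $\phi\in H^\infty(\mathbb{D})$ let $M_\phi g=\phi g$ be the multiplication operator on $H^2(\mathbb{D})$ and $M_\phi^*$ its Hilbert space adjoint. For a connected open set $\Omega\subseteq\mathbb{C}$ and an integer $n\ge 1$, let $\mathcal{B}_n(\Omega)$ be the set of bounded linear operators $T$ on a complex Hilbert space $\mathbb{H}$ such that (a) $\Omega\subseteq\sigma(T)$; (b) $\operatorname{ran}(T-\omega)=\mathbb{H}$ for all $\omega\in\Omega$; (c) the closed linear span of $\bigcup_{\omega\in\Omega}\ker(T-\omega)$ is $\mathbb{H}$; (d) $\dim\ker(T-\omega)=n$ for all $\omega\in\Omega$. Call $\phi\in H^\infty(\mathbb{D})$ a Cowen-Douglas function if $M_\phi^*\in\mathcal{B}_n(\bar\phi(\mathbb{D}))$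 for some $n\ge1$, where $\bar\phi(\mathbb{D})=\{\overline{\phi(z)}:z\in\mathbb{D}\}$. Let $T$ be a bounded linear operator on a Banach space $X$. - $T$ is hypercyclic if some orbit $\{T^nx:n\ge0\}$ is dense in $X$. - $T$ is strongly mixing if for all nonempty open $U,V\subseteq X$ there is $N$ with $T^n(U)\cap V\neq\emptyset$ for all $n\ge N$. - $T$ is Devaney chaotic if it is topologically transitive (for all nonempty open $U,V$ there is $n\geq 0$ with $T^n(U)\cap V\ne\emptyset$), its periodic points are dense, and it has sensitive dependence on initial conditions (there is $\delta>0$ such that for every $x$ and $\varepsilon>0$ there are $y$ with $\|y-x\|<\varepsilon$ and $n\geq 0$ with $\|T^ny-T^nx\|>\delta$). - $T$ is Li-Yorke chaotic if there is $x\in X$ with $\limsup_{n}\|T^nx\|>0$ (possibly $\infty$) and $\liminf_{n}\|T^nx\|=0$. - $T$ is distributionally chaotic if there is $x\in X$ such that, with $F_x^n(\tau)=\frac1n\#\{0\le i\le n:\|T^ix\|<\tau\}$, one has $\liminf_n F_x^n(\tau)=0$ for some $\tau>0$ and $\limsup_n F_x^n(\epsilon)=1$ for all $\epsilon>0$. **Theorem.**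 If $\phi\in H^\infty(\mathbb{D})$ is a Cowen-Douglas function, then the following assertions are equivalent: 1. $M_\phi^*$ is Devaney chaotic; 2. $M_\phi^*$ is distributionally chaotic; 3. $M_\phi^*$ is strongly mixing; 4. $M_\phi^*$ is Li-Yorke chaotic; 5. $M_\phi^*$ is hypercyclic; 6. $\phi(\mathbb{D})\cap\mathbb{T}\neq\emptyset$. -/

import Mathlib

open Set Filter Topology Metric Complex

noncomputable section

/-! ### The Hardy space `H²(𝔻)` and the algebra `H^∞(𝔻)`

Functions on the open unit disc `𝔻 = ball 0 1` are represented by total functions `ℂ → ℂ`;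
the elements of `H²(𝔻)` are normalised to vanish outside `𝔻`, so that two elements are equal
iff they agree on `𝔻`. -/

/-- The integral means `(2π)⁻¹ ∫ |g(r e^{iθ})|² dθ`, for `0 < r < 1`. -/
def hardyMeans (g : ℂ → ℂ) : Set ℝ :=
  (fun r : ℝ => Real.circleAverage (fun z => ‖g z‖ ^ 2) 0 r) '' Ioo 0 1

/-- `g ∈ H²(𝔻)`: `g` is analytic on `𝔻` and its integral means are bounded. -/
structure MemHardy (g : ℂ → ℂ) : Prop where
  differentiableOn : DifferentiableOn ℂ g (ball 0 1)
  eq_zero : ∀ z, z ∉ ball (0 : ℂ) 1 → g z = 0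
  bddAbove : BddAbove (hardyMeans g)

/-- `φ ∈ H^∞(𝔻)`: `φ` is analytic and bounded on `𝔻` (its values elsewhere are irrelevant). -/
def MemHInfty (φ : ℂ → ℂ) : Prop :=
  DifferentiableOn ℂ φ (ball 0 1) ∧ ∃ C : ℝ, ∀ z ∈ ball (0 : ℂ) 1, ‖φ z‖ ≤ C

/-- The norm `‖g‖ = (sup_{r<1} (2π)⁻¹ ∫ |g(r e^{iθ})|² dθ)^{1/2}` of `H²(𝔻)`. -/
def hardyNorm (g : ℂ → ℂ) : ℝ := √(sSup (hardyMeans g))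

/-- The `n`-th Taylor coefficient at `0`. -/
def taylorCoeff (g : ℂ → ℂ) (n : ℕ) : ℂ := (n.factorial : ℂ)⁻¹ * iteratedDeriv n g 0

lemma hasSum_taylorCoeff {g : ℂ → ℂ} (hg : DifferentiableOn ℂ g (ball 0 1)) {z : ℂ}
    (hz : z ∈ ball (0 : ℂ) 1) : HasSum (fun n => taylorCoeff g n * z ^ n) (g z) := by
  have h := Complex.hasSum_taylorSeries_on_ball (r := 1) hg hz
  refine h.congr_fun ?_
  intro n
  simp [taylorCoeff]; ring

lemma taylorCoeff_add {f g : ℂ → ℂ} (hf : DifferentiableOn ℂ f (ball 0 1))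
    (hg : DifferentiableOn ℂ g (ball 0 1)) (n : ℕ) :
    taylorCoeff (f + g) n = taylorCoeff f n + taylorCoeff g n := by
  have h0 : ball (0 : ℂ) 1 ∈ 𝓝 (0 : ℂ) := ball_mem_nhds _ one_pos
  simp only [taylorCoeff]
  rw [iteratedDeriv_add (hf.analyticAt h0).contDiffAt (hg.analyticAt h0).contDiffAt, mul_add]

lemma taylorCoeff_smul (c : ℂ) (f : ℂ → ℂ) (n : ℕ) :
    taylorCoeff (c • f) n = c * taylorCoeff f n := by
  have : (c • f) = fun x => c * f x := rfl
  simp only [taylorCoeff]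
  rw [this, iteratedDeriv_const_mul_field]; ring

lemma circleAverage_conj_pow_mul {g : ℂ → ℂ} (hg : DifferentiableOn ℂ g (ball 0 1)) {r : ℝ}
    (hr : r ∈ Ioo (0 : ℝ) 1) (n : ℕ) :
    Real.circleAverage (fun z => (starRingEnd ℂ) z ^ n * g z) 0 r =
      (r : ℂ) ^ (2 * n) * taylorCoeff g n := by
  have hd : DifferentiableOn ℂ g (closedBall 0 r) := hg.mono (closedBall_subset_ball hr.2)
  have h := hd.circleIntegral_one_div_sub_center_pow_smul hr.1 n
  have h1 : Real.circleAverage (fun z => (starRingEnd ℂ) z ^ n * g z) 0 r =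
      Real.circleAverage (fun z => (r : ℂ) ^ (2 * n) • ((1 / z ^ n) * g z)) 0 r := by
    apply Real.circleAverage_congr_sphere
    intro z hz
    have hz' : ‖z‖ = r := by simpa [abs_of_pos hr.1] using hz
    have hz0 : z ≠ 0 := by
      rw [← norm_pos_iff, hz']; exact hr.1
    have hc : (starRingEnd ℂ) z * z = (r : ℂ) ^ 2 := by
      rw [mul_comm, Complex.mul_conj, Complex.normSq_eq_norm_sq, hz']; push_cast; rfl
    simp only [smul_eq_mul]
    rw [pow_mul, ← hc, mul_pow]
    field_simp
  rw [h1, Real.circleAverage_eq_circleIntegral hr.1.ne']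
  have h2 : (∮ z in C(0, r), (z - 0)⁻¹ • ((r : ℂ) ^ (2 * n) • ((1 / z ^ n) * g z))) =
      (r : ℂ) ^ (2 * n) • ∮ z in C(0, r), (1 / (z - 0) ^ (n + 1)) • g z := by
    rw [← circleIntegral.integral_smul]
    congr 1
    ext z
    simp only [sub_zero, smul_eq_mul, pow_succ, one_div, mul_inv]
    ring
  rw [h2, h]
  simp only [taylorCoeff, smul_eq_mul]
  have : (2 * (Real.pi : ℂ) * I) ≠ 0 := Complex.two_pi_I_ne_zero
  field_simp

lemma continuousOn_sphere_of_hardy {g : ℂ → ℂ} (hg : DifferentiableOn ℂ g (ball 0 1)) {r : ℝ}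
    (hr : r ∈ Ioo (0 : ℝ) 1) : ContinuousOn g (sphere 0 r) :=
  hg.continuousOn.mono (sphere_subset_closedBall.trans (closedBall_subset_ball hr.2))

lemma hasSum_mean {g : ℂ → ℂ} (hg : DifferentiableOn ℂ g (ball 0 1)) {r : ℝ}
    (hr : r ∈ Ioo (0 : ℝ) 1) :
    HasSum (fun n => ‖taylorCoeff g n‖ ^ 2 * r ^ (2 * n))
      (Real.circleAverage (fun z => ‖g z‖ ^ 2) 0 r) := by
  have hcont := continuousOn_sphere_of_hardy hg hr
  obtain ⟨M, hM⟩ := (isCompact_sphere (0 : ℂ) r).exists_bound_of_continuousOn hcont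
  have hmem : ∀ θ, circleMap 0 r θ ∈ sphere (0 : ℂ) r := fun θ =>
    circleMap_mem_sphere 0 hr.1.le θ
  have hmemb : ∀ θ, circleMap 0 r θ ∈ ball (0 : ℂ) 1 := fun θ => by
    simp [abs_of_pos hr.1, hr.2]
  have hgc : Continuous fun θ => g (circleMap 0 r θ) :=
    hcont.comp_continuous (continuous_circleMap 0 r) hmem
  have hrb : (r : ℂ) ∈ ball (0 : ℂ) 1 := by simp [abs_of_pos hr.1, hr.2]
  have hsum : Summable fun n => ‖taylorCoeff g n‖ * r ^ n := by
    have := (hasSum_taylorCoeff hg hrb).summable.norm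
    simpa [abs_of_pos hr.1] using this
  have key : HasSum
      (fun n => ∫ θ in (0 : ℝ)..2 * Real.pi, (starRingEnd ℂ) (taylorCoeff g n) *
        ((starRingEnd ℂ) (circleMap 0 r θ) ^ n * g (circleMap 0 r θ)))
      (∫ θ in (0 : ℝ)..2 * Real.pi, ((‖g (circleMap 0 r θ)‖ ^ 2 : ℝ) : ℂ)) := by
    apply intervalIntegral.hasSum_integral_of_dominated_convergence
      (fun n _ => ‖taylorCoeff g n‖ * r ^ n * M)
    · intro n
      apply Continuous.aestronglyMeasurable
      exact continuous_const.mul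
        (((Complex.continuous_conj.comp (continuous_circleMap 0 r)).pow n).mul hgc)
    · intro n
      refine Eventually.of_forall fun θ _ => ?_
      rw [norm_mul, norm_mul, norm_pow, RCLike.norm_conj, RCLike.norm_conj, ← mul_assoc]
      have : ‖circleMap 0 r θ‖ = r := by simp [abs_of_pos hr.1]
      rw [this]
      have h0 := hr.1.le
      exact mul_le_mul_of_nonneg_left (hM _ (hmem θ)) (by positivity)
    · exact Eventually.of_forall fun θ _ => hsum.mul_right M
    · exact intervalIntegrable_const
    · refine Eventually.of_forall fun θ _ => ?_
      have h := (hasSum_taylorCoeff hg (hmemb θ)).map (starRingEnd ℂ) Complex.continuous_conj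
      have h2 := h.mul_right (g (circleMap 0 r θ))
      have e : (starRingEnd ℂ) (g (circleMap 0 r θ)) * g (circleMap 0 r θ) =
          ((‖g (circleMap 0 r θ)‖ ^ 2 : ℝ) : ℂ) := by
        rw [mul_comm, Complex.mul_conj, Complex.normSq_eq_norm_sq]
      rw [e] at h2
      refine h2.congr_fun fun n => ?_
      simp [mul_assoc]
  have key2 := key.mul_left ((2 * Real.pi : ℝ)⁻¹ : ℂ)
  have e1 : ((2 * Real.pi : ℝ)⁻¹ : ℂ) *
      (∫ θ in (0 : ℝ)..2 * Real.pi, ((‖g (circleMap 0 r θ)‖ ^ 2 : ℝ) : ℂ)) =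
      ((Real.circleAverage (fun z => ‖g z‖ ^ 2) 0 r : ℝ) : ℂ) := by
    rw [intervalIntegral.integral_ofReal, Real.circleAverage]
    simp
  rw [e1] at key2
  rw [← Complex.hasSum_ofReal]
  refine key2.congr_fun fun n => ?_
  rw [intervalIntegral.integral_const_mul]
  have h3 := circleAverage_conj_pow_mul hg hr n
  rw [Real.circleAverage, Complex.real_smul] at h3
  rw [mul_left_comm, ← Complex.ofReal_inv, h3]
  have h4 : (starRingEnd ℂ) (taylorCoeff g n) * taylorCoeff g n =
      ((‖taylorCoeff g n‖ ^ 2 : ℝ) : ℂ) := by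
    rw [mul_comm, Complex.mul_conj, Complex.normSq_eq_norm_sq]
  rw [mul_left_comm, h4]
  push_cast
  ring

/-- `g` has bounded integral means iff its Taylor coefficients are square summable, and then
the supremum of the means is the sum of the squares. -/
lemma summable_of_bddAbove {g : ℂ → ℂ} (hg : DifferentiableOn ℂ g (ball 0 1)) {C : ℝ}
    (hC : ∀ m ∈ hardyMeans g, m ≤ C) (s : Finset ℕ) : ∑ n ∈ s, ‖taylorCoeff g n‖ ^ 2 ≤ C := by
  have hlim : Tendsto (fun r : ℝ => ∑ n ∈ s, ‖taylorCoeff g n‖ ^ 2 * r ^ (2 * n)) (𝓝[<] 1)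
      (𝓝 (∑ n ∈ s, ‖taylorCoeff g n‖ ^ 2 * 1 ^ (2 * n))) := by
    apply Tendsto.mono_left _ nhdsWithin_le_nhds
    apply Continuous.tendsto (by fun_prop : Continuous
      (fun r : ℝ => ∑ n ∈ s, ‖taylorCoeff g n‖ ^ 2 * r ^ (2 * n)))
  simp only [one_pow, mul_one] at hlim
  refine le_of_tendsto hlim ?_
  filter_upwards [Ioo_mem_nhdsLT (zero_lt_one' ℝ)] with r hr
  have h := hasSum_mean hg hr
  have h0 := hr.1.le
  exact (sum_le_hasSum s (fun n _ => by positivity) h).trans (hC _ ⟨r, hr, rfl⟩)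

lemma mean_le_tsum {g : ℂ → ℂ} (hg : DifferentiableOn ℂ g (ball 0 1))
    (hs : Summable fun n => ‖taylorCoeff g n‖ ^ 2) {m : ℝ} (hm : m ∈ hardyMeans g) :
    m ≤ ∑' n, ‖taylorCoeff g n‖ ^ 2 := by
  obtain ⟨r, hr, rfl⟩ := hm
  refine hasSum_le (fun n => ?_) (hasSum_mean hg hr) hs.hasSum
  exact mul_le_of_le_one_right (by positivity) (pow_le_one₀ hr.1.le hr.2.le)

lemma hardyMeans_nonempty (g : ℂ → ℂ) : (hardyMeans g).Nonempty :=
  ⟨_, 1 / 2, ⟨by norm_num, by norm_num⟩, rfl⟩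

lemma MemHardy.summable {g : ℂ → ℂ} (hg : MemHardy g) :
    Summable fun n => ‖taylorCoeff g n‖ ^ 2 := by
  obtain ⟨C, hC⟩ := hg.bddAbove
  exact summable_of_sum_le (fun n => by positivity)
    (summable_of_bddAbove hg.differentiableOn hC)

lemma memHardy_of_summable {g : ℂ → ℂ} (hg : DifferentiableOn ℂ g (ball 0 1))
    (h0 : ∀ z, z ∉ ball (0 : ℂ) 1 → g z = 0)
    (hs : Summable fun n => ‖taylorCoeff g n‖ ^ 2) : MemHardy g :=
  ⟨hg, h0, _, fun _ hm => mean_le_tsum hg hs hm⟩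

lemma MemHardy.sSup_eq {g : ℂ → ℂ} (hg : MemHardy g) :
    sSup (hardyMeans g) = ∑' n, ‖taylorCoeff g n‖ ^ 2 := by
  apply le_antisymm
  · exact csSup_le (hardyMeans_nonempty g) fun m hm =>
      mean_le_tsum hg.differentiableOn hg.summable hm
  · exact hg.summable.tsum_le_of_sum_le
      (summable_of_bddAbove hg.differentiableOn fun m hm => le_csSup hg.bddAbove hm)

lemma MemHardy.memℓp {g : ℂ → ℂ} (hg : MemHardy g) : Memℓp (taylorCoeff g) 2 := by
  apply memℓp_gen
  simpa using hg.summable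

lemma MemHardy.zero : MemHardy 0 := by
  refine memHardy_of_summable (differentiableOn_const 0) (fun _ _ => rfl) ?_
  have : taylorCoeff 0 = 0 := by
    ext n
    have := taylorCoeff_smul 0 0 n
    simpa using this
  simp [this]

lemma MemHardy.add {f g : ℂ → ℂ} (hf : MemHardy f) (hg : MemHardy g) : MemHardy (f + g) := by
  have hd := hf.differentiableOn.add hg.differentiableOn
  refine memHardy_of_summable hd
    (fun z hz => by simp [hf.eq_zero z hz, hg.eq_zero z hz]) ?_
  have h := (hf.memℓp.add hg.memℓp).summable (by simp)
  have e : taylorCoeff (f + g) = taylorCoeff f + taylorCoeff g :=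
    funext (taylorCoeff_add hf.differentiableOn hg.differentiableOn)
  rw [e]
  simpa using h

lemma MemHardy.smul (c : ℂ) {f : ℂ → ℂ} (hf : MemHardy f) : MemHardy (c • f) := by
  refine memHardy_of_summable (hf.differentiableOn.const_smul c)
    (fun z hz => by simp [hf.eq_zero z hz]) ?_
  simp only [taylorCoeff_smul, norm_mul, mul_pow]
  exact hf.summable.mul_left _

/-- The vector space underlying `H²(𝔻)`. -/
def hardySubmodule : Submodule ℂ (ℂ → ℂ) where
  carrier := {g | MemHardy g}
  zero_mem' := MemHardy.zero
  add_mem' := MemHardy.add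
  smul_mem' := fun c _ hf => MemHardy.smul c hf

/-- The Hardy space `H²(𝔻)`. -/
def HardySpace : Type := hardySubmodule

namespace HardySpace

instance : AddCommGroup HardySpace := inferInstanceAs (AddCommGroup hardySubmodule)
instance : Module ℂ HardySpace := inferInstanceAs (Module ℂ hardySubmodule)
instance : CoeFun HardySpace (fun _ => ℂ → ℂ) := ⟨fun g => g.1⟩

lemma ext_ball {f g : HardySpace} (h : ∀ z ∈ ball (0 : ℂ) 1, f z = g z) : f = g := by
  refine Subtype.ext (funext fun z => ?_)
  by_cases hz : z ∈ ball (0 : ℂ) 1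
  · exact h z hz
  · exact (f.2.eq_zero z hz).trans (g.2.eq_zero z hz).symm

@[simp] lemma add_apply (f g : HardySpace) (z : ℂ) : (f + g) z = f z + g z := rfl
@[simp] lemma smul_apply (c : ℂ) (f : HardySpace) (z : ℂ) : (c • f) z = c * f z := rfl

/-- The sequence of Taylor coefficients, as a linear map to `ℓ²`. -/
def coeffs : HardySpace →ₗ[ℂ] lp (fun _ : ℕ => ℂ) 2 where
  toFun g := ⟨taylorCoeff g, g.2.memℓp⟩
  map_add' f g := by
    ext n
    exact taylorCoeff_add f.2.differentiableOn g.2.differentiableOn n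
  map_smul' c f := by
    ext n
    exact taylorCoeff_smul c f n

lemma coeffs_apply (g : HardySpace) (n : ℕ) : coeffs g n = taylorCoeff g n := rfl

lemma norm_coeffs (g : HardySpace) : ‖coeffs g‖ = hardyNorm g := by
  have h := lp.norm_rpow_eq_tsum (p := 2) (by simp) (coeffs g)
  simp only [ENNReal.toReal_ofNat, Real.rpow_ofNat, coeffs_apply] at h
  rw [hardyNorm, g.2.sSup_eq, ← h, Real.sqrt_sq (norm_nonneg _)]

lemma coeffs_injective : Function.Injective coeffs := by
  intro f g h
  apply ext_ball
  intro z hz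
  have hf := hasSum_taylorCoeff f.2.differentiableOn hz
  have hg := hasSum_taylorCoeff g.2.differentiableOn hz
  have e : taylorCoeff f = taylorCoeff g := congrArg Subtype.val h
  rw [e] at hf
  exact hf.unique hg

lemma coeffs_surjective : Function.Surjective coeffs := by
  intro a
  let p := FormalMultilinearSeries.ofScalars ℂ (fun n => a n)
  have hrad : 1 ≤ p.radius := by
    have := p.le_radius_of_bound ‖a‖ (r := 1) (fun n => by
      simpa [p, FormalMultilinearSeries.ofScalars_norm] using lp.norm_apply_le_norm (by simp) a n)
    simpa using this
  have hp := (p.hasFPowerSeriesOnBall (zero_lt_one.trans_le hrad)).mono zero_lt_one hrad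
  let g : ℂ → ℂ := (ball (0 : ℂ) 1).indicator p.sum
  have hball : Metric.eball (0 : ℂ) 1 = ball 0 1 := by
    simpa using Metric.eball_ofReal (x := (0 : ℂ)) (ε := 1)
  have hg : HasFPowerSeriesOnBall g p 0 1 := by
    refine hp.congr fun z hz => ?_
    rw [hball] at hz
    simp only [g]
    rw [Set.indicator_of_mem hz]
  have hd : DifferentiableOn ℂ g (ball 0 1) := by
    rw [← hball]; exact hg.differentiableOn
  have hc : taylorCoeff g = a := by
    ext n
    have h1 := hg.factorial_smul 1 n
    rw [iteratedFDeriv_apply_eq_iteratedDeriv_mul_prod] at h1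
    simp only [Finset.prod_const_one, one_smul] at h1
    rw [taylorCoeff, ← h1]
    have hn : (n.factorial : ℂ) ≠ 0 := by exact_mod_cast n.factorial_ne_zero
    simp [p, hn]
  have hm : MemHardy g := by
    refine memHardy_of_summable hd (fun z hz => Set.indicator_of_notMem hz _) ?_
    rw [hc]
    have := (lp.memℓp a).summable (by simp)
    simpa using this
  exact ⟨⟨g, hm⟩, Subtype.ext hc⟩

instance : NormedAddCommGroup HardySpace :=
  AddGroupNorm.toNormedAddCommGroup
    { toFun := fun g => hardyNorm g
      map_zero' := by rw [← norm_coeffs]; simp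
      add_le' := fun f g => by
        rw [← norm_coeffs, ← norm_coeffs, ← norm_coeffs, map_add]; exact norm_add_le _ _
      neg' := fun f => by rw [← norm_coeffs, ← norm_coeffs, map_neg, norm_neg]
      eq_zero_of_map_eq_zero' := fun f hf => by
        rw [← norm_coeffs, norm_eq_zero] at hf
        exact coeffs_injective (hf.trans (map_zero coeffs).symm) }

lemma norm_def (g : HardySpace) : ‖g‖ = hardyNorm g := rfl

instance : NormedSpace ℂ HardySpace where
  norm_smul_le c f := by
    rw [norm_def, norm_def, ← norm_coeffs, ← norm_coeffs, map_smul, norm_smul]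

/-- The inner product that induces the norm, `⟪f, g⟫ = ∑ conj (aₙ) bₙ` for the Taylor
coefficients `aₙ` of `f` and `bₙ` of `g` (linear in the second argument). -/
instance : InnerProductSpace ℂ HardySpace where
  inner f g := inner ℂ (coeffs f) (coeffs g)
  norm_sq_eq_re_inner f := by
    rw [norm_def, ← norm_coeffs]; exact norm_sq_eq_re_inner (𝕜 := ℂ) _
  conj_inner_symm f g := inner_conj_symm _ _
  add_left f g h := by rw [map_add, inner_add_left]
  smul_left f g c := by rw [map_smul, inner_smul_left]

/-- `H²(𝔻)` is isometrically isomorphic to `ℓ²` through the Taylor coefficients. -/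
def coeffsEquiv : HardySpace ≃ₗᵢ[ℂ] lp (fun _ : ℕ => ℂ) 2 where
  toLinearEquiv := LinearEquiv.ofBijective coeffs ⟨coeffs_injective, coeffs_surjective⟩
  norm_map' := norm_coeffs

instance : CompleteSpace HardySpace :=
  coeffsEquiv.toIsometryEquiv.completeSpace

end HardySpace

lemma MemHInfty.mean_mul_le {φ g : ℂ → ℂ} (hφ : DifferentiableOn ℂ φ (ball 0 1)) {C : ℝ}
    (hC : ∀ z ∈ ball (0 : ℂ) 1, ‖φ z‖ ≤ C) (hg : MemHardy g) {m : ℝ}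
    (hm : m ∈ hardyMeans (φ * g)) : m ≤ C ^ 2 * sSup (hardyMeans g) := by
  obtain ⟨r, hr, rfl⟩ := hm
  have c1 := continuousOn_sphere_of_hardy (hφ.mul hg.differentiableOn) hr
  have c2 := continuousOn_sphere_of_hardy hg.differentiableOn hr
  have h : Real.circleAverage (fun z => ‖(φ * g) z‖ ^ 2) 0 r ≤
      Real.circleAverage (fun z => C ^ 2 • ‖g z‖ ^ 2) 0 r := by
    apply Real.circleAverage_mono
    · exact (c1.norm.pow 2).circleIntegrable hr.1.le
    · exact ((c2.norm.pow 2).const_smul (C ^ 2)).circleIntegrable hr.1.le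
    · intro z hz
      have hz' : z ∈ ball (0 : ℂ) 1 := by
        have : ‖z‖ = r := by simpa [abs_of_pos hr.1] using hz
        simpa [this] using hr.2
      simp only [Pi.mul_apply, norm_mul, mul_pow, smul_eq_mul]
      gcongr
      exact hC z hz'
  rw [Real.circleAverage_fun_smul, smul_eq_mul] at h
  exact h.trans (mul_le_mul_of_nonneg_left (le_csSup hg.bddAbove ⟨r, hr, rfl⟩) (sq_nonneg C))

lemma MemHInfty.memHardy_mul {φ g : ℂ → ℂ} (hφ : MemHInfty φ) (hg : MemHardy g) :
    MemHardy (φ * g) := by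
  obtain ⟨hd, C, hC⟩ := hφ
  exact ⟨hd.mul hg.differentiableOn, fun z hz => by simp [hg.eq_zero z hz],
    _, fun m hm => MemHInfty.mean_mul_le hd hC hg hm⟩

/-- The multiplication operator `M_φ g = φ g` on `H²(𝔻)`, for `φ ∈ H^∞(𝔻)`. -/
def mulOp (φ : ℂ → ℂ) (hφ : MemHInfty φ) : HardySpace →L[ℂ] HardySpace :=
  LinearMap.mkContinuousOfExistsBound
    { toFun := fun g => (⟨φ * g.1, hφ.memHardy_mul g.2⟩ : hardySubmodule)
      map_add' := fun f g => Subtype.ext (mul_add φ f.1 g.1)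
      map_smul' := fun c f => Subtype.ext (mul_smul_comm c φ f.1) }
    (by
      obtain ⟨hd, C, hC⟩ := id hφ
      refine ⟨C, fun g => ?_⟩
      have hC0 : 0 ≤ C := (norm_nonneg _).trans (hC 0 (by simp))
      change √(sSup (hardyMeans (φ * g.1))) ≤ C * √(sSup (hardyMeans g.1))
      have h := Real.sqrt_le_sqrt (csSup_le (hardyMeans_nonempty (φ * g.1))
        fun m hm => MemHInfty.mean_mul_le hd hC g.2 hm)
      rwa [Real.sqrt_mul (sq_nonneg C), Real.sqrt_sq hC0] at h)

lemma mulOp_apply (φ : ℂ → ℂ) (hφ : MemHInfty φ) (g : HardySpace) (z : ℂ) :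
    mulOp φ hφ g z = φ z * g z := rfl

/-! ### Cowen-Douglas operators and functions -/

/-- The class `B_n(Ω)` of operators on a Hilbert space, for a connected open set `Ω ⊆ ℂ`. -/
structure IsCowenDouglas {H : Type*} [NormedAddCommGroup H] [InnerProductSpace ℂ H]
    (n : ℕ) (Ω : Set ℂ) (T : H →L[ℂ] H) : Prop where
  isOpen : IsOpen Ω
  isConnected : IsConnected Ω
  subset_spectrum : Ω ⊆ spectrum ℂ T
  range_eq : ∀ ω ∈ Ω, (T - ω • ContinuousLinearMap.id ℂ H).range = ⊤
  span_ker : (⨆ ω ∈ Ω, (T - ω • ContinuousLinearMap.id ℂ H).ker).topologicalClosure = ⊤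
  rank_ker : ∀ ω ∈ Ω, Module.rank ℂ (T - ω • ContinuousLinearMap.id ℂ H).ker = n

/-- `φ ∈ H^∞(𝔻)` is a Cowen-Douglas function if `M_φ^* ∈ B_n(Ω)` for some `n ≥ 1`, where
`Ω = {conj (φ z) : z ∈ 𝔻}`. -/
def IsCowenDouglasFunction (φ : ℂ → ℂ) (hφ : MemHInfty φ) : Prop :=
  ∃ n : ℕ, 1 ≤ n ∧ IsCowenDouglas n ((fun z => (starRingEnd ℂ) (φ z)) '' ball 0 1)
    (ContinuousLinearMap.adjoint (mulOp φ hφ))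

/-! ### Chaos for bounded linear operators -/

section Chaos

variable {X : Type*} [NormedAddCommGroup X] [NormedSpace ℂ X]

/-- Some vector has a dense orbit. -/
def IsHypercyclic (T : X →L[ℂ] X) : Prop :=
  ∃ x : X, Dense (range fun n : ℕ => (T ^ n) x)

/-- For all nonempty open `U`, `V` there is `n` with `T^n(U) ∩ V ≠ ∅`. -/
def IsTopTransitive (T : X →L[ℂ] X) : Prop :=
  ∀ U V : Set X, IsOpen U → U.Nonempty → IsOpen V → V.Nonempty →
    ∃ n : ℕ, ((T ^ n) '' U ∩ V).Nonempty

/-- Strong (topological) mixing: for all nonempty open `U`, `V`, `T^n(U) ∩ V ≠ ∅` for all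
large `n`. -/
def IsStronglyMixing (T : X →L[ℂ] X) : Prop :=
  ∀ U V : Set X, IsOpen U → U.Nonempty → IsOpen V → V.Nonempty →
    ∃ N : ℕ, ∀ n ≥ N, ((T ^ n) '' U ∩ V).Nonempty

/-- Sensitive dependence on initial conditions. -/
def HasSensitiveDependence (T : X →L[ℂ] X) : Prop :=
  ∃ δ > 0, ∀ x : X, ∀ ε > 0, ∃ y : X, ‖y - x‖ < ε ∧ ∃ n : ℕ, δ < ‖(T ^ n) y - (T ^ n) x‖

/-- Devaney chaos: topological transitivity, a dense set of periodic points, and sensitive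
dependence on initial conditions. -/
def IsDevaneyChaotic (T : X →L[ℂ] X) : Prop :=
  IsTopTransitive T ∧ Dense (Function.periodicPts T) ∧ HasSensitiveDependence T

/-- Li-Yorke chaos: some `x` has `limsup ‖T^n x‖ > 0` (possibly `∞`) and `liminf ‖T^n x‖ = 0`. -/
def IsLiYorkeChaotic (T : X →L[ℂ] X) : Prop :=
  ∃ x : X, 0 < limsup (fun n : ℕ => ‖(T ^ n) x‖ₑ) atTop ∧
    liminf (fun n : ℕ => ‖(T ^ n) x‖ₑ) atTop = 0

/-- `F_x^n(τ) = (1/n) #{0 ≤ i ≤ n : ‖T^i x‖ < τ}`. -/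
def distrFun (T : X →L[ℂ] X) (x : X) (τ : ℝ) (n : ℕ) : ℝ :=
  ({i ∈ Finset.range (n + 1) | ‖(T ^ i) x‖ < τ}.card : ℝ) / n

/-- Distributional chaos: for some `x`, `liminf_n F_x^n(τ) = 0` for some `τ > 0` and
`limsup_n F_x^n(ε) = 1` for all `ε > 0`. -/
def IsDistributionallyChaotic (T : X →L[ℂ] X) : Prop :=
  ∃ x : X, (∃ τ > 0, liminf (distrFun T x τ) atTop = 0) ∧
    ∀ ε > 0, limsup (distrFun T x ε) atTop = 1

end Chaos

end

/-! The reproducing kernel at `w` is an eigenvector of the adjoint `T` of multiplication by `φ`,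
with eigenvalue the conjugate of `φ w` (`adjoint_mulOp_kernel`). By the identity theorem, kernels at
points accumulating inside the disc span a dense subspace (`dense_span_kernel`).

The open set in the Cowen-Douglas condition forces `φ` to be nonconstant, hence open. So if `φ w` is
unimodular, then near `w` there are points accumulating at `w` where `‖φ‖ < 1`, others where `‖φ‖ >
1`, and others where `φ` is a root of unity. The three families of kernels give dense spaces of
vectors with null orbits, with null backward orbits, and of periodic points. Kitai's criterion then
gives mixing, hence hypercyclicity by Birkhoff's theorem. Null orbits together with one orbit
escaping to infinity give distributional chaos by a Baire argument, hence Li-Yorke chaos. Periodic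
points and the escaping orbit complete Devaney chaos.

Conversely, if `φ` omits the circle, connectedness of the disc gives `‖φ‖ ≤ 1` throughout or `‖φ‖ ≥
1` throughout. Then `T` is contractive or expansive (`adjoint_mulOp_contractive_or_expansive`), the
norms along each orbit are monotone, and every form of chaos fails. -/

/-! ### Frequencies -/

/-- The frequency `(1/n) #{0 ≤ i ≤ n : p i}`. -/
noncomputable def visitFreq (p : ℕ → Prop) [DecidablePred p] (n : ℕ) : ℝ :=
  ({i ∈ Finset.range (n + 1) | p i}.card : ℝ) / n

lemma visitFreq_nonneg (p : ℕ → Prop) [DecidablePred p] (n : ℕ) : 0 ≤ visitFreq p n := by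
  unfold visitFreq; positivity

lemma visitFreq_le (p : ℕ → Prop) [DecidablePred p] (n : ℕ) :
    visitFreq p n ≤ ((n : ℝ) + 1) / n := by
  unfold visitFreq
  gcongr
  have := Finset.card_filter_le (Finset.range (n + 1)) p
  rw [Finset.card_range] at this
  exact_mod_cast this

lemma visitFreq_mono {p q : ℕ → Prop} [DecidablePred p] [DecidablePred q] {n : ℕ}
    (h : ∀ i ∈ Finset.range (n + 1), p i → q i) : visitFreq p n ≤ visitFreq q n := by
  unfold visitFreq
  have : {i ∈ Finset.range (n + 1) | p i} ⊆ {i ∈ Finset.range (n + 1) | q i} := by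
    intro i hi
    rw [Finset.mem_filter] at hi ⊢
    exact ⟨hi.1, h i hi.1 hi.2⟩
  gcongr

/-- The frequency is the Cesàro mean of the indicator of `p` plus the term `i = n`, which
contributes at most `1 / n`. -/
lemma tendsto_visitFreq {p : ℕ → Prop} [DecidablePred p] {l : ℝ}
    (h : Tendsto (fun i => if p i then (1 : ℝ) else 0) atTop (𝓝 l)) :
    Tendsto (visitFreq p) atTop (𝓝 l) := by
  have h1 := h.cesaro
  have h2 : Tendsto (fun n : ℕ => (if p n then (1 : ℝ) else 0) * (n : ℝ)⁻¹) atTop (𝓝 (l * 0)) :=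
    h.mul tendsto_inv_atTop_nhds_zero_nat
  have h3 := h1.add h2
  rw [mul_zero, add_zero] at h3
  refine h3.congr fun n => ?_
  rw [visitFreq, Finset.card_filter, Nat.cast_sum, Finset.sum_range_succ]
  push_cast
  ring

lemma tendsto_visitFreq_one {p : ℕ → Prop} [DecidablePred p] (h : ∀ᶠ i in atTop, p i) :
    Tendsto (visitFreq p) atTop (𝓝 1) :=
  tendsto_visitFreq (tendsto_const_nhds.congr' (h.mono fun i hi => by simp [hi]))

lemma tendsto_visitFreq_zero {p : ℕ → Prop} [DecidablePred p] (h : ∀ᶠ i in atTop, ¬ p i) :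
    Tendsto (visitFreq p) atTop (𝓝 0) :=
  tendsto_visitFreq (tendsto_const_nhds.congr' (h.mono fun i hi => by simp [hi]))

lemma isBoundedUnder_le_visitFreq (p : ℕ → Prop) [DecidablePred p] :
    IsBoundedUnder (· ≤ ·) atTop (visitFreq p) := by
  refine isBoundedUnder_of ⟨2, fun n => (visitFreq_le p n).trans ?_⟩
  rcases Nat.eq_zero_or_pos n with rfl | hn
  · simp
  · have : (1 : ℝ) ≤ n := by exact_mod_cast hn
    rw [div_le_iff₀ (by positivity)]; linarith

lemma isBoundedUnder_ge_visitFreq (p : ℕ → Prop) [DecidablePred p] :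
    IsBoundedUnder (· ≥ ·) atTop (visitFreq p) :=
  isBoundedUnder_of ⟨0, visitFreq_nonneg p⟩

lemma liminf_visitFreq_eq_zero {p : ℕ → Prop} [DecidablePred p]
    (h : ∀ ε > 0, ∃ᶠ n in atTop, visitFreq p n < ε) : liminf (visitFreq p) atTop = 0 := by
  apply le_antisymm
  · refine le_of_forall_pos_le_add fun ε hε => ?_
    rw [zero_add]
    exact liminf_le_of_frequently_le ((h ε hε).mono fun n hn => hn.le)
      (isBoundedUnder_ge_visitFreq p)
  · exact le_liminf_of_le (isBoundedUnder_le_visitFreq p).isCoboundedUnder_ge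
      (Eventually.of_forall (visitFreq_nonneg p))

/-- Since `n + 1` indices are counted but divided by `n`, a frequency can exceed 1; the upper bound
holds only in the limit, through `(n + 1) / n → 1`. -/
lemma limsup_visitFreq_eq_one {p : ℕ → Prop} [DecidablePred p]
    (h : ∀ ε > 0, ∃ᶠ n in atTop, 1 - ε < visitFreq p n) : limsup (visitFreq p) atTop = 1 := by
  have hlim : Tendsto (fun n : ℕ => ((n : ℝ) + 1) / n) atTop (𝓝 1) := by
    have h0 : Tendsto (fun n : ℕ => 1 + (n : ℝ)⁻¹) atTop (𝓝 (1 + 0)) :=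
      tendsto_const_nhds.add tendsto_inv_atTop_nhds_zero_nat
    rw [add_zero] at h0
    refine h0.congr' ((eventually_gt_atTop 0).mono fun n hn => ?_)
    have : (n : ℝ) ≠ 0 := by positivity
    field_simp
  apply le_antisymm
  · rw [← hlim.limsup_eq]
    exact limsup_le_limsup (Eventually.of_forall (visitFreq_le p))
      (isBoundedUnder_ge_visitFreq p).isCoboundedUnder_le hlim.isBoundedUnder_le
  · refine le_of_forall_pos_le_add fun ε hε => ?_
    rw [← sub_le_iff_le_add]
    exact le_limsup_of_frequently_le ((h ε hε).mono fun n hn => hn.le)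
      (isBoundedUnder_le_visitFreq p)

/-! ### Chaos criteria for bounded operators -/

section Criteria

variable {X : Type*} [NormedAddCommGroup X] [NormedSpace ℂ X] {T : X →L[ℂ] X}

lemma distrFun_eq_visitFreq (T : X →L[ℂ] X) (x : X) (τ : ℝ) :
    distrFun T x τ = visitFreq fun i => ‖(T ^ i) x‖ < τ := rfl

lemma IsStronglyMixing.isTopTransitive (h : IsStronglyMixing T) : IsTopTransitive T := by
  intro U V hU hU' hV hV'
  obtain ⟨N, hN⟩ := h U V hU hU' hV hV'
  exact ⟨N, hN N le_rfl⟩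

/-- Birkhoff's transitivity theorem. -/
lemma IsTopTransitive.isHypercyclic [CompleteSpace X] [SecondCountableTopology X]
    (h : IsTopTransitive T) : IsHypercyclic T := by
  have hB := TopologicalSpace.isBasis_countableBasis X
  -- Baire category: points whose orbit meets a given basic open set form an open set, dense by
  -- transitivity, and there are countably many basic sets.
  have hd : Dense (⋂ B ∈ TopologicalSpace.countableBasis X, ⋃ n : ℕ, (T ^ n) ⁻¹' B) := by
    refine dense_biInter_of_isOpen (fun B hB' => isOpen_iUnion fun n =>
      (hB.isOpen hB').preimage (T ^ n).continuous)
      (TopologicalSpace.countable_countableBasis X) fun B hB' => ?_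
    rw [dense_iff_inter_open]
    intro U hU hU'
    obtain ⟨n, y, ⟨x, hx, rfl⟩, hy⟩ := h U B hU hU' (hB.isOpen hB')
      (TopologicalSpace.nonempty_of_mem_countableBasis hB')
    exact ⟨x, hx, mem_iUnion.2 ⟨n, hy⟩⟩
  obtain ⟨x, hx⟩ := hd.nonempty
  refine ⟨x, hB.dense_iff.2 fun B hB' _ => ?_⟩
  obtain ⟨n, hn⟩ := mem_iUnion.1 (mem_iInter₂.1 hx B hB')
  exact ⟨_, hn, n, rfl⟩

/-- The vectors whose orbit tends to `0`. -/
def nullOrbits (T : X →L[ℂ] X) : Submodule ℂ X where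
  carrier := {x | Tendsto (fun n : ℕ => (T ^ n) x) atTop (𝓝 0)}
  zero_mem' := by simp
  add_mem' {x y} hx hy := by
    have := Tendsto.add hx hy
    simpa using this
  smul_mem' c x hx := by
    have := Tendsto.const_smul hx c
    rw [smul_zero] at this
    exact this.congr fun n => (map_smul (T ^ n) c x).symm

lemma mem_nullOrbits {x : X} :
    x ∈ nullOrbits T ↔ Tendsto (fun n : ℕ => (T ^ n) x) atTop (𝓝 0) := Iff.rfl

/-- The vectors with a sequence of preimages under the powers of `T` that tends to `0`. -/
def nullBackwardOrbits (T : X →L[ℂ] X) : Submodule ℂ X where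
  carrier := {x | ∃ u : ℕ → X, Tendsto u atTop (𝓝 0) ∧ ∀ n, (T ^ n) (u n) = x}
  zero_mem' := ⟨0, tendsto_const_nhds, by simp⟩
  add_mem' := by
    rintro x y ⟨u, hu, hu'⟩ ⟨v, hv, hv'⟩
    refine ⟨u + v, ?_, fun n => by rw [Pi.add_apply, map_add, hu', hv']⟩
    have := hu.add hv
    rwa [add_zero] at this
  smul_mem' := by
    rintro c x ⟨u, hu, hu'⟩
    refine ⟨c • u, ?_, fun n => by rw [Pi.smul_apply, map_smul, hu']⟩
    have := hu.const_smul c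
    rwa [smul_zero] at this

/-- The periodic points of a linear operator form a subspace. -/
def periodicSubmodule (T : X →L[ℂ] X) : Submodule ℂ X where
  carrier := Function.periodicPts T
  zero_mem' := ⟨1, one_pos, by simp [Function.IsPeriodicPt, Function.IsFixedPt]⟩
  add_mem' := by
    rintro x y ⟨m, hm, hx⟩ ⟨n, hn, hy⟩
    refine ⟨m * n, Nat.mul_pos hm hn, ?_⟩
    have hx' := hx.mul_const n
    have hy' := hy.const_mul m
    rw [Function.IsPeriodicPt, Function.IsFixedPt, ← pow_apply_eq_iterate] at *
    rw [map_add, hx', hy']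
  smul_mem' := by
    rintro c x ⟨m, hm, hx⟩
    refine ⟨m, hm, ?_⟩
    rw [Function.IsPeriodicPt, Function.IsFixedPt, ← pow_apply_eq_iterate] at *
    rw [map_smul, hx]

lemma pow_apply_of_eigenvector {x : X} {c : ℂ} (h : T x = c • x) (n : ℕ) :
    (T ^ n) x = c ^ n • x := by
  induction n with
  | zero => simp
  | succ n ih => rw [pow_succ', mul_apply_eq_comp, ih, map_smul, h, smul_smul, pow_succ]

lemma mem_nullOrbits_of_eigenvector {x : X} {c : ℂ} (h : T x = c • x) (hc : ‖c‖ < 1) :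
    x ∈ nullOrbits T := by
  rw [mem_nullOrbits]
  simp only [pow_apply_of_eigenvector h]
  have := (tendsto_pow_atTop_nhds_zero_of_norm_lt_one hc).smul_const x
  rwa [zero_smul] at this

/-- The scaled vectors `c⁻¹ ^ n • x` are preimages of `x` under the powers of `T` and shrink
geometrically. -/
lemma mem_nullBackwardOrbits_of_eigenvector {x : X} {c : ℂ} (h : T x = c • x) (hc : 1 < ‖c‖) :
    x ∈ nullBackwardOrbits T := by
  have hc0 : c ≠ 0 := norm_pos_iff.1 (one_pos.trans hc)
  refine ⟨fun n => c⁻¹ ^ n • x, ?_, fun n => ?_⟩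
  · have := (tendsto_pow_atTop_nhds_zero_of_norm_lt_one (x := c⁻¹)
      (by rw [norm_inv]; exact inv_lt_one_of_one_lt₀ hc)).smul_const x
    rwa [zero_smul] at this
  · rw [map_smul, pow_apply_of_eigenvector h, smul_smul, ← mul_pow, inv_mul_cancel₀ hc0, one_pow,
      one_smul]

lemma mem_periodicSubmodule_of_eigenvector {x : X} {c : ℂ} (h : T x = c • x) {m : ℕ} (hm : 0 < m)
    (hc : c ^ m = 1) : x ∈ periodicSubmodule T := by
  refine ⟨m, hm, ?_⟩
  rw [Function.IsPeriodicPt, Function.IsFixedPt, ← pow_apply_eq_iterate,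
    pow_apply_of_eigenvector h, hc, one_smul]

lemma tendsto_norm_pow_of_eigenvector {x : X} {c : ℂ} (h : T x = c • x) (hx : x ≠ 0)
    (hc : 1 < ‖c‖) : Tendsto (fun n : ℕ => ‖(T ^ n) x‖) atTop atTop := by
  simp only [pow_apply_of_eigenvector h, norm_smul, norm_pow]
  exact (tendsto_pow_atTop_atTop_of_one_lt hc).atTop_mul_const (norm_pos_iff.2 hx)

/-- Kitai's criterion. -/
lemma isStronglyMixing_of_dense (h₁ : Dense (nullOrbits T : Set X))
    (h₂ : Dense (nullBackwardOrbits T : Set X)) : IsStronglyMixing T := by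
  intro U V hU hU' hV hV'
  obtain ⟨x, hxU, hx⟩ := h₁.inter_open_nonempty U hU hU'
  obtain ⟨y, hyV, u, hu, hu'⟩ := h₂.inter_open_nonempty V hV hV'
  -- The point `x + u n` is close to `x`, while its image under `T ^ n` is `T ^ n x + y`, close to
  -- `y`.
  have e1 : Tendsto (fun n => x + u n) atTop (𝓝 x) := by
    have := (tendsto_const_nhds (x := x)).add hu
    rwa [add_zero] at this
  have e2 : Tendsto (fun n => (T ^ n) (x + u n)) atTop (𝓝 y) := by
    have := (mem_nullOrbits.1 hx).add (tendsto_const_nhds (x := y))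
    rw [zero_add] at this
    exact this.congr fun n => by rw [map_add, hu']
  obtain ⟨N, hN⟩ := eventually_atTop.1
    ((e1.eventually (hU.mem_nhds hxU)).and (e2.eventually (hV.mem_nhds hyV)))
  exact ⟨N, fun n hn => ⟨_, ⟨_, (hN n hn).1, rfl⟩, (hN n hn).2⟩⟩

/-- By linearity, perturbing any `x` by a small nonzero multiple of `y` separates the orbits by that
multiple of the orbit of `y`, which is unbounded; so `δ = 1` serves. -/
lemma hasSensitiveDependence_of_tendsto {y : X}
    (hy : Tendsto (fun n : ℕ => ‖(T ^ n) y‖) atTop atTop) : HasSensitiveDependence T := by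
  refine ⟨1, one_pos, fun x ε hε => ?_⟩
  have hc : Tendsto (fun m : ℕ => ‖((m : ℂ) + 1)⁻¹ • y‖) atTop (𝓝 0) := by
    have h := (tendsto_one_div_add_atTop_nhds_zero_nat (𝕜 := ℝ)).mul_const ‖y‖
    rw [zero_mul] at h
    refine h.congr fun m => ?_
    rw [norm_smul, norm_inv, one_div]
    norm_cast
  obtain ⟨m, hm⟩ := (hc.eventually_lt_const hε).exists
  have hm0 : 0 < ‖((m : ℂ) + 1)⁻¹‖ := by
    rw [norm_pos_iff]; exact inv_ne_zero (Nat.cast_add_one_ne_zero m)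
  obtain ⟨n, hn⟩ := ((hy.const_mul_atTop hm0).eventually_gt_atTop 1).exists
  refine ⟨x + ((m : ℂ) + 1)⁻¹ • y, by simpa using hm, n, ?_⟩
  rw [map_add, add_sub_cancel_left, map_smul, norm_smul]
  exact hn

/-- The vectors whose orbit tends in norm to infinity are dense if there is one and the orbits
that tend to `0` are dense. -/
lemma dense_tendsto_atTop (h₁ : Dense (nullOrbits T : Set X)) {y : X}
    (hy : Tendsto (fun n : ℕ => ‖(T ^ n) y‖) atTop atTop) :
    Dense {x | Tendsto (fun n : ℕ => ‖(T ^ n) x‖) atTop atTop} := by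
  rw [← dense_closure]
  refine h₁.mono fun x hx => ?_
  -- A small multiple of `y` added to a vector with null orbit yields an orbit that still escapes,
  -- by the reverse triangle inequality.
  have hlim : Tendsto (fun m : ℕ => x + (1 / ((m : ℂ) + 1)) • y) atTop (𝓝 x) := by
    have h := (tendsto_const_nhds (x := x)).add
      ((tendsto_one_div_add_atTop_nhds_zero_nat (𝕜 := ℂ)).smul_const y)
    rwa [zero_smul, add_zero] at h
  refine mem_closure_of_tendsto hlim (Eventually.of_forall fun m => ?_)
  have hm0 : 0 < ‖1 / ((m : ℂ) + 1)‖ := by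
    rw [norm_pos_iff]; exact one_div_ne_zero (Nat.cast_add_one_ne_zero m)
  have h := (mem_nullOrbits.1 hx).norm.neg.add_atTop (hy.const_mul_atTop hm0)
  refine tendsto_atTop_mono (fun n => ?_) h
  rw [map_add, map_smul, ← norm_smul, neg_add_eq_sub, add_comm ((T ^ n) x)]
  exact norm_sub_le_norm_add ((1 / ((m : ℂ) + 1)) • (T ^ n) y) ((T ^ n) x)

/-- Only finitely many iterates matter, and each strict inequality persists near `x`, so the count
cannot drop nearby. -/
lemma isOpen_lt_visitFreq (T : X →L[ℂ] X) (τ c : ℝ) (n : ℕ) :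
    IsOpen {x | c < visitFreq (fun i => ‖(T ^ i) x‖ < τ) n} := by
  rw [isOpen_iff_mem_nhds]
  intro x hx
  have h : ∀ᶠ y in 𝓝 x, ∀ i ∈ Finset.range (n + 1), ‖(T ^ i) x‖ < τ → ‖(T ^ i) y‖ < τ := by
    rw [eventually_all_finset]
    intro i _
    by_cases hi : ‖(T ^ i) x‖ < τ
    · exact ((T ^ i).continuous.norm.continuousAt.eventually_lt_const hi).mono fun y hy _ => hy
    · exact Eventually.of_forall fun y h => absurd h hi
  filter_upwards [h] with y hy
  exact lt_of_lt_of_le hx (visitFreq_mono hy)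

/-- Here the non-strict `≤ τ` is essential: its failure is an open condition, so the count cannot
rise near `x`. -/
lemma isOpen_visitFreq_lt (T : X →L[ℂ] X) (τ c : ℝ) (n : ℕ) :
    IsOpen {x | visitFreq (fun i => ‖(T ^ i) x‖ ≤ τ) n < c} := by
  rw [isOpen_iff_mem_nhds]
  intro x hx
  have h : ∀ᶠ y in 𝓝 x, ∀ i ∈ Finset.range (n + 1), ‖(T ^ i) y‖ ≤ τ → ‖(T ^ i) x‖ ≤ τ := by
    rw [eventually_all_finset]
    intro i _
    by_cases hi : ‖(T ^ i) x‖ ≤ τ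
    · exact Eventually.of_forall fun y _ => hi
    · exact ((T ^ i).continuous.norm.continuousAt.eventually_const_lt (not_le.1 hi)).mono
        fun y hy h => absurd h (not_le.2 hy)
  filter_upwards [h] with y hy
  exact lt_of_le_of_lt (visitFreq_mono hy) hx

/-- An operator with a dense set of orbits that tend to `0` and an orbit that tends in norm to
infinity is distributionally chaotic. -/
lemma isDistributionallyChaotic_of_dense [CompleteSpace X] (h₁ : Dense (nullOrbits T : Set X))
    {y : X} (hy : Tendsto (fun n : ℕ => ‖(T ^ n) y‖) atTop atTop) :
    IsDistributionallyChaotic T := by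
  -- Points of `A k` have, at some time `n ≥ k`, spent almost all of it near 0; points of `B k` have
  -- spent almost all of it outside the unit ball. Null orbits lie in every `A k` and escaping ones
  -- in every `B k`, so Baire yields one vector in all of them; `n ≥ k` makes both behaviours recur.
  let A : ℕ → Set X := fun k => ⋃ n ≥ k,
    {x | 1 - 1 / ((k : ℝ) + 1) < visitFreq (fun i => ‖(T ^ i) x‖ < 1 / ((k : ℝ) + 1)) n}
  let B : ℕ → Set X := fun k => ⋃ n ≥ k,
    {x | visitFreq (fun i => ‖(T ^ i) x‖ ≤ 1) n < 1 / ((k : ℝ) + 1)}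
  have hA : ∀ k, IsOpen (A k) := fun k =>
    isOpen_biUnion fun n _ => isOpen_lt_visitFreq _ _ _ _
  have hB : ∀ k, IsOpen (B k) := fun k =>
    isOpen_biUnion fun n _ => isOpen_visitFreq_lt _ _ _ _
  have hk : ∀ k : ℕ, (0 : ℝ) < 1 / ((k : ℝ) + 1) := fun k => Nat.one_div_pos_of_nat
  have hA' : ∀ k, Dense (A k) := fun k => by
    refine h₁.mono fun x hx => ?_
    have h := tendsto_visitFreq_one ((mem_nullOrbits.1 hx).norm.eventually_lt_const
      (by simpa using hk k : ‖(0 : X)‖ < 1 / ((k : ℝ) + 1)))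
    obtain ⟨n, hn, hn'⟩ := ((h.eventually_const_lt (sub_lt_self 1 (hk k))).and
      (eventually_ge_atTop k)).exists
    exact mem_iUnion₂.2 ⟨n, hn', hn⟩
  have hB' : ∀ k, Dense (B k) := fun k => by
    refine (dense_tendsto_atTop h₁ hy).mono fun x hx => ?_
    have h := tendsto_visitFreq_zero (p := fun i => ‖(T ^ i) x‖ ≤ 1)
      ((Tendsto.eventually_gt_atTop hx 1).mono fun i hi => not_le.2 hi)
    obtain ⟨n, hn, hn'⟩ := ((h.eventually_lt_const (hk k)).and (eventually_ge_atTop k)).exists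
    exact mem_iUnion₂.2 ⟨n, hn', hn⟩
  have hd : Dense (⋂ k, A k ∩ B k) := dense_iInter_of_isOpen_nat
    (fun k => (hA k).inter (hB k)) fun k => (hA' k).inter_of_isOpen_left (hB' k) (hA k)
  obtain ⟨x, hx⟩ := hd.nonempty
  rw [mem_iInter] at hx
  refine ⟨x, ⟨1, one_pos, ?_⟩, fun ε hε => ?_⟩
  · rw [distrFun_eq_visitFreq]
    refine liminf_visitFreq_eq_zero fun ε hε => frequently_atTop.2 fun N => ?_
    obtain ⟨k, hkN, hkε⟩ := ((eventually_ge_atTop N).and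
      (tendsto_one_div_add_atTop_nhds_zero_nat.eventually_lt_const hε)).exists
    obtain ⟨n, hn, hn'⟩ := mem_iUnion₂.1 (hx k).2
    exact ⟨n, hkN.trans hn, ((visitFreq_mono fun i _ h => le_of_lt h).trans_lt hn').trans hkε⟩
  · rw [distrFun_eq_visitFreq]
    refine limsup_visitFreq_eq_one fun δ hδ => frequently_atTop.2 fun N => ?_
    obtain ⟨k, hkN, hkε⟩ := ((eventually_ge_atTop N).and
      (tendsto_one_div_add_atTop_nhds_zero_nat.eventually_lt_const (lt_min hε hδ))).exists
    obtain ⟨n, hn, hn'⟩ := mem_iUnion₂.1 (hx k).1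
    refine ⟨n, hkN.trans hn, lt_of_lt_of_le ?_
      (visitFreq_mono fun i _ h => lt_trans h (hkε.trans_le (min_le_left _ _)))⟩
    exact (sub_lt_sub_left (hkε.trans_le (min_le_right _ _)) 1).trans hn'

/-- If the norms tended to 0, the frequency of visits to the `τ`-ball would tend to 1, against
liminf 0. If they were eventually above some `r > 0`, the frequency of visits to the `r`-ball would
tend to 0, against limsup 1. -/
lemma IsDistributionallyChaotic.isLiYorkeChaotic (h : IsDistributionallyChaotic T) :
    IsLiYorkeChaotic T := by
  obtain ⟨x, ⟨τ, hτ, h0⟩, h1⟩ := h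
  refine ⟨x, pos_iff_ne_zero.2 fun hs => ?_, ?_⟩
  · have hev : ∀ᶠ n : ℕ in atTop, ‖(T ^ n) x‖ < τ := by
      have : limsup (fun n : ℕ => ‖(T ^ n) x‖ₑ) atTop < ENNReal.ofReal τ := by
        rw [hs]; exact ENNReal.ofReal_pos.2 hτ
      refine (eventually_lt_of_limsup_lt this).mono fun n hn => ?_
      rwa [← ofReal_norm, ENNReal.ofReal_lt_ofReal_iff hτ] at hn
    rw [distrFun_eq_visitFreq, (tendsto_visitFreq_one hev).liminf_eq] at h0
    exact one_ne_zero h0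
  · by_contra hs
    obtain ⟨r, hr0, hr⟩ := ENNReal.lt_iff_exists_nnreal_btwn.1 (pos_iff_ne_zero.2 hs)
    have hr0' : (0 : ℝ) < r := by exact_mod_cast hr0
    have hev : ∀ᶠ n : ℕ in atTop, ¬ ‖(T ^ n) x‖ < r := by
      refine (eventually_lt_of_lt_liminf hr).mono fun n hn => ?_
      rw [enorm_eq_nnnorm, ENNReal.coe_lt_coe] at hn
      exact not_lt.2 (le_of_lt (by exact_mod_cast hn))
    have h2 := h1 r hr0'
    rw [distrFun_eq_visitFreq, (tendsto_visitFreq_zero hev).limsup_eq] at h2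
    exact zero_ne_one h2

/-! ### Operators with monotone orbits are not chaotic -/

lemma norm_pow_antitone (hT : ∀ x, ‖T x‖ ≤ ‖x‖) (x : X) :
    Antitone fun n : ℕ => ‖(T ^ n) x‖ :=
  antitone_nat_of_succ_le fun n => by
    rw [pow_succ', mul_apply_eq_comp]; exact hT _

lemma norm_pow_monotone (hT : ∀ x, ‖x‖ ≤ ‖T x‖) (x : X) :
    Monotone fun n : ℕ => ‖(T ^ n) x‖ :=
  monotone_nat_of_le_succ fun n => by
    rw [pow_succ', mul_apply_eq_comp]; exact hT _

/-- Monotone norms converge in `[0, ∞]`, so limsup and liminf coincide. -/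
lemma not_isLiYorkeChaotic (hT : (∀ x, ‖T x‖ ≤ ‖x‖) ∨ ∀ x, ‖x‖ ≤ ‖T x‖) :
    ¬ IsLiYorkeChaotic T := by
  rintro ⟨x, h1, h0⟩
  have hlim : ∃ l, Tendsto (fun n : ℕ => ‖(T ^ n) x‖ₑ) atTop (𝓝 l) := by
    simp only [← ofReal_norm]
    rcases hT with hT | hT
    · exact ⟨_, tendsto_atTop_iInf fun m n h =>
        ENNReal.ofReal_le_ofReal (norm_pow_antitone hT x h)⟩
    · exact ⟨_, tendsto_atTop_iSup fun m n h =>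
        ENNReal.ofReal_le_ofReal (norm_pow_monotone hT x h)⟩
  obtain ⟨l, hl⟩ := hlim
  rw [hl.limsup_eq, ← hl.liminf_eq, h0] at h1
  exact lt_irrefl _ h1

lemma exists_one_lt_norm (X : Type*) [NormedAddCommGroup X] [NormedSpace ℂ X] [Nontrivial X] :
    ∃ x : X, 1 < ‖x‖ := NormedSpace.exists_lt_norm ℂ X 1

/-- A contraction never leaves the unit ball and an expansion never enters it from outside.
Nontriviality supplies vectors outside the ball. -/
lemma not_isTopTransitive [Nontrivial X] (hT : (∀ x, ‖T x‖ ≤ ‖x‖) ∨ ∀ x, ‖x‖ ≤ ‖T x‖) :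
    ¬ IsTopTransitive T := by
  intro h
  have ho : IsOpen {x : X | 1 < ‖x‖} := isOpen_lt continuous_const continuous_norm
  rcases hT with hT | hT
  · obtain ⟨n, _, ⟨x, hx, rfl⟩, hy⟩ := h (ball 0 1) {x | 1 < ‖x‖} isOpen_ball (by simp) ho
      (exists_one_lt_norm X)
    have := norm_pow_antitone hT x (Nat.zero_le n)
    rw [mem_ball_zero_iff] at hx
    simp only [pow_zero, one_apply_eq_self, mem_ofPred_eq] at this hy
    linarith
  · obtain ⟨n, _, ⟨x, hx, rfl⟩, hy⟩ := h {x | 1 < ‖x‖} (ball 0 1) ho (exists_one_lt_norm X)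
      isOpen_ball (by simp)
    have := norm_pow_monotone hT x (Nat.zero_le n)
    rw [mem_ball_zero_iff] at hy
    simp only [pow_zero, one_apply_eq_self, mem_ofPred_eq] at this hx
    linarith

lemma not_isHypercyclic [Nontrivial X] (hT : (∀ x, ‖T x‖ ≤ ‖x‖) ∨ ∀ x, ‖x‖ ≤ ‖T x‖) :
    ¬ IsHypercyclic T := by
  rintro ⟨x, hx⟩
  rcases hT with hT | hT
  · obtain ⟨z, hz⟩ := NormedSpace.exists_lt_norm ℂ X ‖x‖
    obtain ⟨_, hy, n, rfl⟩ := hx.inter_open_nonempty {y | ‖x‖ < ‖y‖}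
      (isOpen_lt continuous_const continuous_norm) ⟨z, hz⟩
    exact (norm_pow_antitone hT x (Nat.zero_le n)).not_gt (by simpa using hy)
  -- An expansive orbit stays outside the ball of radius `‖x‖`, which excludes density only if that
  -- ball is nonempty; the zero vector has a constant orbit and is treated apart.
  · have hx0 : x ≠ 0 := by
      rintro rfl
      obtain ⟨_, hy, n, rfl⟩ := hx.inter_open_nonempty {y | 1 < ‖y‖}
        (isOpen_lt continuous_const continuous_norm) (exists_one_lt_norm X)
      simp only [map_zero, mem_ofPred_eq, norm_zero] at hy
      linarith
    obtain ⟨_, hy, n, rfl⟩ := hx.inter_open_nonempty (ball 0 ‖x‖) isOpen_ball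
      ⟨0, by simpa using hx0⟩
    rw [mem_ball_zero_iff] at hy
    exact (norm_pow_monotone hT x (Nat.zero_le n)).not_gt (by simpa using hy)

end Criteria

/-! ### Reproducing kernels of the Hardy space -/

namespace HardySpace

lemma memℓp_conj_pow (w : ball (0 : ℂ) 1) :
    Memℓp (fun n : ℕ => (starRingEnd ℂ) (w : ℂ) ^ n) 2 := by
  apply memℓp_gen
  have hw : ‖(w : ℂ)‖ < 1 := mem_ball_zero_iff.1 w.2
  have : Summable fun n : ℕ => (‖(w : ℂ)‖ ^ 2) ^ n :=
    summable_geometric_of_lt_one (sq_nonneg _) (pow_lt_one₀ (norm_nonneg _) hw two_ne_zero)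
  refine this.congr fun n => ?_
  simp only [norm_pow, RCLike.norm_conj, ENNReal.toReal_ofNat, Real.rpow_ofNat]
  ring

/-- The reproducing kernel of `H²(𝔻)` at `w`. -/
noncomputable def kernel (w : ball (0 : ℂ) 1) : HardySpace :=
  coeffsEquiv.symm ⟨fun n : ℕ => (starRingEnd ℂ) (w : ℂ) ^ n, memℓp_conj_pow w⟩

lemma inner_kernel (w : ball (0 : ℂ) 1) (g : HardySpace) : inner ℂ (kernel w) g = g w := by
  have h1 : coeffs (kernel w) = ⟨fun n : ℕ => (starRingEnd ℂ) (w : ℂ) ^ n, memℓp_conj_pow w⟩ :=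
    coeffsEquiv.apply_symm_apply _
  have h2 : HasSum (fun n => inner ℂ (coeffs (kernel w) n) (coeffs g n))
      (inner ℂ (kernel w) g) := lp.hasSum_inner _ _
  refine h2.unique ((hasSum_taylorCoeff g.2.differentiableOn w.2).congr_fun fun n => ?_)
  rw [h1, coeffs_apply]
  simp

lemma kernel_ne_zero (w : ball (0 : ℂ) 1) : kernel w ≠ 0 := by
  intro h
  have h1 : coeffs (kernel w) = ⟨fun n : ℕ => (starRingEnd ℂ) (w : ℂ) ^ n, memℓp_conj_pow w⟩ :=
    coeffsEquiv.apply_symm_apply _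
  have h2 := congrArg (fun a : lp (fun _ : ℕ => ℂ) 2 => a 0) h1
  rw [h] at h2
  simp at h2

instance : Nontrivial HardySpace := ⟨kernel ⟨0, by simp⟩, 0, kernel_ne_zero _⟩

/-- The kernels at a set of points that accumulates inside the disc span a dense subspace. -/
lemma dense_span_kernel {P : ℂ → Prop} {z₀ : ℂ} (hz₀ : z₀ ∈ ball (0 : ℂ) 1)
    (hP : ∃ᶠ z in 𝓝[≠] z₀, P z) :
    Dense (Submodule.span ℂ (kernel '' {w | P w}) : Set HardySpace) := by
  rw [Submodule.dense_iff_topologicalClosure_eq_top, Submodule.topologicalClosure_eq_top_iff,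
    Submodule.eq_bot_iff]
  intro g hg
  rw [Submodule.mem_orthogonal] at hg
  refine ext_ball fun z hz => ?_
  -- A vector `g` orthogonal to these kernels vanishes at points accumulating at `z₀`, so the
  -- identity theorem applies.
  refine (g.2.differentiableOn.analyticOnNhd
    isOpen_ball).eqOn_zero_of_preconnected_of_frequently_eq_zero
    (convex_ball (0 : ℂ) 1).isPreconnected hz₀ ?_ hz
  have hev : ∀ᶠ z in 𝓝[≠] z₀, z ∈ ball (0 : ℂ) 1 :=
    nhdsWithin_le_nhds (isOpen_ball.mem_nhds hz₀)
  refine (hP.and_eventually hev).mono fun z h => ?_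
  have := hg _ (Submodule.subset_span ⟨⟨z, h.2⟩, h.1, rfl⟩)
  rwa [inner_kernel] at this

instance : SecondCountableTopology HardySpace := by
  have hlim : Tendsto (fun n : ℕ => 1 / ((n : ℂ) + 1)) atTop (𝓝[≠] 0) :=
    tendsto_nhdsWithin_iff.2 ⟨tendsto_one_div_add_atTop_nhds_zero_nat,
      Eventually.of_forall fun n => one_div_ne_zero (Nat.cast_add_one_ne_zero n)⟩
  -- Countably many kernels suffice for separability. The value 1 at `n = 0` lies outside the disc
  -- and indexes no kernel.
  have hd := dense_span_kernel (P := fun z => z ∈ range fun n : ℕ => 1 / ((n : ℂ) + 1))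
    (mem_ball_self one_pos) (hlim.frequently (Frequently.of_forall fun n => mem_range_self n))
  have hc : (kernel '' {w | (w : ℂ) ∈ range fun n : ℕ => 1 / ((n : ℂ) + 1)}).Countable :=
    ((countable_range _).preimage Subtype.val_injective).image _
  have hs := hc.isSeparable.span (R := ℂ)
  have : TopologicalSpace.SeparableSpace HardySpace :=
    TopologicalSpace.isSeparable_univ_iff.1 (hd.closure_eq ▸ hs.closure)
  exact UniformSpace.secondCountable_of_separable HardySpace

end HardySpace

open HardySpace

/-! ### Multiplication operators -/

lemma norm_mulOp_le {φ : ℂ → ℂ} (hφ : MemHInfty φ) {C : ℝ}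
    (hC : ∀ z ∈ ball (0 : ℂ) 1, ‖φ z‖ ≤ C) (g : HardySpace) : ‖mulOp φ hφ g‖ ≤ C * ‖g‖ := by
  have hC0 : 0 ≤ C := (norm_nonneg _).trans (hC 0 (by simp))
  change √(sSup (hardyMeans (φ * g.1))) ≤ C * √(sSup (hardyMeans g.1))
  have h := Real.sqrt_le_sqrt (csSup_le (hardyMeans_nonempty (φ * g.1))
    fun m hm => MemHInfty.mean_mul_le hφ.1 hC g.2 hm)
  rwa [Real.sqrt_mul (sq_nonneg C), Real.sqrt_sq hC0] at h

lemma norm_adjoint_mulOp_apply_le {φ : ℂ → ℂ} (hφ : MemHInfty φ)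
    (hC : ∀ z ∈ ball (0 : ℂ) 1, ‖φ z‖ ≤ 1) (g : HardySpace) :
    ‖ContinuousLinearMap.adjoint (mulOp φ hφ) g‖ ≤ ‖g‖ := by
  have h : ‖ContinuousLinearMap.adjoint (mulOp φ hφ)‖ ≤ 1 := by
    rw [LinearIsometryEquiv.norm_map]
    exact ContinuousLinearMap.opNorm_le_bound _ zero_le_one fun g => norm_mulOp_le hφ hC g
  simpa using ContinuousLinearMap.le_of_opNorm_le _ h g

/-- The reciprocal of `φ` is analytic and bounded by 1. Taking adjoints in `M_φ M_{1/φ} = 1` makes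
the contraction `M_{1/φ}^*` a left inverse of `M_φ^*`. -/
lemma norm_le_norm_adjoint_mulOp_apply {φ : ℂ → ℂ} (hφ : MemHInfty φ)
    (hC : ∀ z ∈ ball (0 : ℂ) 1, 1 ≤ ‖φ z‖) (g : HardySpace) :
    ‖g‖ ≤ ‖ContinuousLinearMap.adjoint (mulOp φ hφ) g‖ := by
  have h0 : ∀ z ∈ ball (0 : ℂ) 1, φ z ≠ 0 := fun z hz =>
    norm_pos_iff.1 (one_pos.trans_le (hC z hz))
  have hb : ∀ z ∈ ball (0 : ℂ) 1, ‖φ⁻¹ z‖ ≤ 1 := fun z hz => by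
    rw [Pi.inv_apply, norm_inv]; exact inv_le_one_of_one_le₀ (hC z hz)
  have hψ : MemHInfty φ⁻¹ := ⟨hφ.1.inv h0, 1, hb⟩
  have hmul : mulOp φ hφ ∘L mulOp φ⁻¹ hψ = ContinuousLinearMap.id ℂ HardySpace := by
    ext1 f
    refine ext_ball fun z hz => ?_
    rw [ContinuousLinearMap.comp_apply, mulOp_apply, mulOp_apply, Pi.inv_apply,
      mul_inv_cancel_left₀ (h0 z hz)]
    rfl
  have hadj := congrArg ContinuousLinearMap.adjoint hmul
  rw [ContinuousLinearMap.adjoint_comp] at hadj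
  have e : ContinuousLinearMap.adjoint (mulOp φ⁻¹ hψ)
      (ContinuousLinearMap.adjoint (mulOp φ hφ) g) = g := by
    have := congrArg (fun S : HardySpace →L[ℂ] HardySpace => S g) hadj
    rwa [← ContinuousLinearMap.one_def, ← ContinuousLinearMap.star_eq_adjoint 1, star_one] at this
  have h := norm_adjoint_mulOp_apply_le hψ hb (ContinuousLinearMap.adjoint (mulOp φ hφ) g)
  rwa [e] at h

/-- Pairing with `g` evaluates `φ g` at `w`; the conjugate appears because the inner product is
conjugate-linear in its first slot. -/
lemma adjoint_mulOp_kernel {φ : ℂ → ℂ} (hφ : MemHInfty φ) (w : ball (0 : ℂ) 1) :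
    ContinuousLinearMap.adjoint (mulOp φ hφ) (kernel w) =
      (starRingEnd ℂ) (φ w) • kernel w := by
  refine ext_inner_right ℂ fun g => ?_
  rw [ContinuousLinearMap.adjoint_inner_left, inner_smul_left, inner_kernel, inner_kernel,
    mulOp_apply, starRingEnd_self_apply]

/-! ### Values of the symbol near a unimodular value -/

lemma frequently_norm_lt_one {u : ℂ} (hu : ‖u‖ = 1) : ∃ᶠ z in 𝓝[≠] u, ‖z‖ < 1 := by
  have hc : Tendsto (fun t : ℝ => (t : ℂ) * u) (𝓝[<] 1) (𝓝 u) := by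
    have : Continuous fun t : ℝ => (t : ℂ) * u := by fun_prop
    have h := this.tendsto 1
    rw [ofReal_one, one_mul] at h
    exact h.mono_left nhdsWithin_le_nhds
  have hev : ∀ᶠ t : ℝ in 𝓝[<] 1, ‖(t : ℂ) * u‖ < 1 := by
    filter_upwards [Ioo_mem_nhdsLT (zero_lt_one' ℝ)] with t ht
    rw [norm_mul, hu, mul_one, norm_real, Real.norm_of_nonneg ht.1.le]
    exact ht.2
  refine (tendsto_nhdsWithin_iff.2 ⟨hc, hev.mono fun t ht =>
    mem_compl_singleton_iff.2 fun h => ?_⟩).frequently hev.frequently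
  rw [h, hu] at ht
  exact lt_irrefl _ ht

lemma frequently_one_lt_norm {u : ℂ} (hu : ‖u‖ = 1) : ∃ᶠ z in 𝓝[≠] u, 1 < ‖z‖ := by
  have hc : Tendsto (fun t : ℝ => (t : ℂ) * u) (𝓝[>] 1) (𝓝 u) := by
    have : Continuous fun t : ℝ => (t : ℂ) * u := by fun_prop
    have h := this.tendsto 1
    rw [ofReal_one, one_mul] at h
    exact h.mono_left nhdsWithin_le_nhds
  have hev : ∀ᶠ t : ℝ in 𝓝[>] 1, 1 < ‖(t : ℂ) * u‖ := by
    filter_upwards [self_mem_nhdsWithin] with t ht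
    rw [norm_mul, hu, mul_one, norm_real, Real.norm_eq_abs]
    exact lt_of_lt_of_le ht (le_abs_self t)
  refine (tendsto_nhdsWithin_iff.2 ⟨hc, hev.mono fun t ht =>
    mem_compl_singleton_iff.2 fun h => ?_⟩).frequently hev.frequently
  rw [h, hu] at ht
  exact lt_irrefl _ ht

/-- Roots of unity accumulate at every point of the unit circle. -/
lemma frequently_pow_eq_one {u : ℂ} (hu : ‖u‖ = 1) :
    ∃ᶠ z in 𝓝[≠] u, ∃ m : ℕ, 0 < m ∧ z ^ m = 1 := by
  obtain ⟨t₀, rfl⟩ : ∃ t₀ : ℝ, cexp ((t₀ : ℂ) * (2 * Real.pi * I)) = u := by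
    obtain ⟨θ, rfl⟩ := (Complex.norm_eq_one_iff u).1 hu
    refine ⟨θ / (2 * Real.pi), ?_⟩
    have : (Real.pi : ℂ) ≠ 0 := by exact_mod_cast Real.pi_ne_zero
    congr 1
    push_cast
    field_simp
  have hd : HasDerivAt (fun t : ℝ => cexp ((t : ℂ) * (2 * Real.pi * I)))
      (cexp ((t₀ : ℂ) * (2 * Real.pi * I)) * (1 * (2 * Real.pi * I))) t₀ :=
    ((hasDerivAt_id t₀).ofReal_comp.mul_const _).cexp
  -- A nonzero derivative keeps nearby parameters off the base value, so rational `t ≠ t₀` give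
  -- roots of unity different from `u`.
  have ht := hd.tendsto_nhdsNE (mul_ne_zero (exp_ne_zero _)
    (by rw [one_mul]; exact two_pi_I_ne_zero))
  refine ht.frequently (Frequently.mono (p := fun t => t ∈ range ((↑) : ℚ → ℝ)) ?_ ?_)
  · rw [← mem_closure_ne_iff_frequently_within]
    exact (Rat.denseRange_cast.sdiff_singleton t₀) t₀
  · rintro _ ⟨q, rfl⟩
    refine ⟨q.den, q.den_pos, ?_⟩
    rw [← exp_nat_mul, exp_eq_one_iff]
    refine ⟨q.num, ?_⟩
    rw [← mul_assoc]
    congr 1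
    have := Rat.den_mul_eq_num q
    exact_mod_cast this

/-- A Cowen-Douglas function maps neighbourhoods to neighbourhoods. -/
lemma IsCowenDouglasFunction.nhds_le_map {φ : ℂ → ℂ} (hφ : MemHInfty φ)
    (hCD : IsCowenDouglasFunction φ hφ) {w : ℂ} (hw : w ∈ ball (0 : ℂ) 1) :
    𝓝 (φ w) ≤ map φ (𝓝 w) := by
  obtain ⟨n, -, h⟩ := hCD
  have ha := hφ.1.analyticOnNhd isOpen_ball
  -- Open mapping dichotomy: a locally constant `φ` would be constant on the disc and its image a
  -- single point, which is not open.
  refine (ha w hw).eventually_constant_or_nhds_le_map_nhds.resolve_left fun hconst => ?_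
  have heq : EqOn φ (fun _ => φ w) (ball 0 1) :=
    ha.eqOn_of_preconnected_of_eventuallyEq analyticOnNhd_const
      (convex_ball (0 : ℂ) 1).isPreconnected hw hconst
  have hsing : (fun z => (starRingEnd ℂ) (φ z)) '' ball 0 1 = {(starRingEnd ℂ) (φ w)} := by
    apply Subset.antisymm
    · rintro _ ⟨z, hz, rfl⟩
      exact congrArg (starRingEnd ℂ) (heq hz)
    · rintro _ rfl
      exact ⟨w, hw, rfl⟩
  exact not_isOpen_singleton _ (hsing ▸ h.isOpen)

/-- Openness of `φ` pulls accumulation at `φ w` back to accumulation at `w`; a point with `φ z ≠ φ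
w` differs from `w`. -/
lemma IsCowenDouglasFunction.frequently_comp {φ : ℂ → ℂ} (hφ : MemHInfty φ)
    (hCD : IsCowenDouglasFunction φ hφ) {w : ℂ} (hw : w ∈ ball (0 : ℂ) 1) {P : ℂ → Prop}
    (hP : ∃ᶠ z in 𝓝[≠] φ w, P z) : ∃ᶠ z in 𝓝[≠] w, P (φ z) := by
  rw [frequently_nhdsWithin_iff] at hP ⊢
  have h := hP.filter_mono (hCD.nhds_le_map hφ hw)
  rw [frequently_map] at h
  exact h.mono fun z hz => ⟨hz.1, fun hzw => hz.2 (congrArg φ hzw)⟩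

lemma IsCowenDouglasFunction.dense_of_frequently {φ : ℂ → ℂ} (hφ : MemHInfty φ)
    (hCD : IsCowenDouglasFunction φ hφ) {w : ℂ} (hw : w ∈ ball (0 : ℂ) 1)
    {P : ℂ → Prop} (hP : ∃ᶠ z in 𝓝[≠] φ w, P z) {S : Submodule ℂ HardySpace}
    (hS : ∀ z : ball (0 : ℂ) 1, P (φ z) → kernel z ∈ S) : Dense (S : Set HardySpace) := by
  refine (dense_span_kernel hw (hCD.frequently_comp hφ hw hP)).mono ?_
  rw [SetLike.coe_subset_coe, Submodule.span_le]
  rintro _ ⟨z, hz, rfl⟩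
  exact hS z hz

/-! ### Dynamics of the adjoint when the symbol takes a unimodular value -/

lemma IsCowenDouglasFunction.dense_nullOrbits {φ : ℂ → ℂ} (hφ : MemHInfty φ)
    (hCD : IsCowenDouglasFunction φ hφ) {w : ℂ} (hw : w ∈ ball (0 : ℂ) 1)
    (hφw : ‖φ w‖ = 1) :
    Dense (nullOrbits (ContinuousLinearMap.adjoint (mulOp φ hφ)) : Set HardySpace) :=
  hCD.dense_of_frequently hφ hw (frequently_norm_lt_one hφw) fun z hz =>
    mem_nullOrbits_of_eigenvector (adjoint_mulOp_kernel hφ z) (by rwa [RCLike.norm_conj])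

lemma IsCowenDouglasFunction.dense_nullBackwardOrbits {φ : ℂ → ℂ} (hφ : MemHInfty φ)
    (hCD : IsCowenDouglasFunction φ hφ) {w : ℂ} (hw : w ∈ ball (0 : ℂ) 1)
    (hφw : ‖φ w‖ = 1) :
    Dense (nullBackwardOrbits (ContinuousLinearMap.adjoint (mulOp φ hφ)) : Set HardySpace) :=
  hCD.dense_of_frequently hφ hw (frequently_one_lt_norm hφw) fun z hz =>
    mem_nullBackwardOrbits_of_eigenvector (adjoint_mulOp_kernel hφ z) (by rwa [RCLike.norm_conj])

lemma IsCowenDouglasFunction.dense_periodicPts {φ : ℂ → ℂ} (hφ : MemHInfty φ)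
    (hCD : IsCowenDouglasFunction φ hφ) {w : ℂ} (hw : w ∈ ball (0 : ℂ) 1)
    (hφw : ‖φ w‖ = 1) :
    Dense (Function.periodicPts (ContinuousLinearMap.adjoint (mulOp φ hφ))) :=
  hCD.dense_of_frequently hφ hw (frequently_pow_eq_one hφw)
    (S := periodicSubmodule (ContinuousLinearMap.adjoint (mulOp φ hφ))) fun z ⟨_, hm, hz⟩ =>
    mem_periodicSubmodule_of_eigenvector (adjoint_mulOp_kernel hφ z) hm
      (by rw [← map_pow, hz, map_one])

lemma IsCowenDouglasFunction.exists_tendsto_atTop {φ : ℂ → ℂ} (hφ : MemHInfty φ)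
    (hCD : IsCowenDouglasFunction φ hφ) {w : ℂ} (hw : w ∈ ball (0 : ℂ) 1)
    (hφw : ‖φ w‖ = 1) : ∃ y, Tendsto
      (fun n : ℕ => ‖(ContinuousLinearMap.adjoint (mulOp φ hφ) ^ n) y‖) atTop atTop := by
  obtain ⟨z, hz, hzb⟩ := ((hCD.frequently_comp hφ hw
    (frequently_one_lt_norm hφw)).and_eventually
      (nhdsWithin_le_nhds (isOpen_ball.mem_nhds hw))).exists
  exact ⟨_, tendsto_norm_pow_of_eigenvector (adjoint_mulOp_kernel hφ ⟨z, hzb⟩)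
    (kernel_ne_zero _) (by rwa [RCLike.norm_conj])⟩

/-- If the symbol omits the unit circle, then the adjoint of the multiplication operator is
contractive or expansive. -/
lemma adjoint_mulOp_contractive_or_expansive {φ : ℂ → ℂ} (hφ : MemHInfty φ)
    (h : ¬ (φ '' ball 0 1 ∩ sphere 0 1).Nonempty) :
    (∀ g, ‖ContinuousLinearMap.adjoint (mulOp φ hφ) g‖ ≤ ‖g‖) ∨
      ∀ g, ‖g‖ ≤ ‖ContinuousLinearMap.adjoint (mulOp φ hφ) g‖ := by
  by_cases h1 : ∀ z ∈ ball (0 : ℂ) 1, ‖φ z‖ ≤ 1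
  · exact Or.inl (norm_adjoint_mulOp_apply_le hφ h1)
  · refine Or.inr (norm_le_norm_adjoint_mulOp_apply hφ fun z hz => ?_)
    by_contra! hlt
    push Not at h1
    obtain ⟨z', hz', hgt⟩ := h1
    -- If `‖φ‖` took values on both sides of 1, the intermediate value theorem on the connected disc
    -- would give a unimodular value.
    obtain ⟨y, hy, hy1⟩ := (convex_ball (0 : ℂ) 1).isPreconnected.intermediate_value hz hz'
      hφ.1.continuousOn.norm ⟨hlt.le, hgt.le⟩
    exact h ⟨φ y, ⟨y, hy, rfl⟩, by simpa using hy1⟩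

theorem theorem11 (φ : ℂ → ℂ) (hφ : MemHInfty φ) (hCD : IsCowenDouglasFunction φ hφ) :
    List.TFAE [
      IsDevaneyChaotic (ContinuousLinearMap.adjoint (mulOp φ hφ)),
      IsDistributionallyChaotic (ContinuousLinearMap.adjoint (mulOp φ hφ)),
      IsStronglyMixing (ContinuousLinearMap.adjoint (mulOp φ hφ)),
      IsLiYorkeChaotic (ContinuousLinearMap.adjoint (mulOp φ hφ)),
      IsHypercyclic (ContinuousLinearMap.adjoint (mulOp φ hφ)),
      (φ '' ball 0 1 ∩ sphere 0 1).Nonempty] := by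
  have hmix : (φ '' ball 0 1 ∩ sphere 0 1).Nonempty →
      IsStronglyMixing (ContinuousLinearMap.adjoint (mulOp φ hφ)) := by
    rintro ⟨_, ⟨w, hw, rfl⟩, hφw⟩
    rw [mem_sphere_zero_iff_norm] at hφw
    exact isStronglyMixing_of_dense (hCD.dense_nullOrbits hφ hw hφw)
      (hCD.dense_nullBackwardOrbits hφ hw hφw)
  tfae_have 6 → 1 := by
    intro h
    refine ⟨(hmix h).isTopTransitive, ?_⟩
    obtain ⟨_, ⟨w, hw, rfl⟩, hφw⟩ := h
    rw [mem_sphere_zero_iff_norm] at hφw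
    obtain ⟨y, hy⟩ := hCD.exists_tendsto_atTop hφ hw hφw
    exact ⟨hCD.dense_periodicPts hφ hw hφw, hasSensitiveDependence_of_tendsto hy⟩
  tfae_have 1 → 6 := fun h => by
    by_contra h6
    exact not_isTopTransitive (adjoint_mulOp_contractive_or_expansive hφ h6) h.1
  tfae_have 6 → 2 := by
    rintro ⟨_, ⟨w, hw, rfl⟩, hφw⟩
    rw [mem_sphere_zero_iff_norm] at hφw
    obtain ⟨y, hy⟩ := hCD.exists_tendsto_atTop hφ hw hφw
    exact isDistributionallyChaotic_of_dense (hCD.dense_nullOrbits hφ hw hφw) hy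
  tfae_have 2 → 4 := fun h => h.isLiYorkeChaotic
  tfae_have 4 → 6 := fun h => by
    by_contra h6
    exact not_isLiYorkeChaotic (adjoint_mulOp_contractive_or_expansive hφ h6) h
  tfae_have 6 → 3 := hmix
  tfae_have 3 → 5 := fun h => h.isTopTransitive.isHypercyclic
  tfae_have 5 → 6 := fun h => by
    by_contra h6
    exact not_isHypercyclic (adjoint_mulOp_contractive_or_expansive hφ h6) h
  tfae_finish
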